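/- Let $G$ be a group. For $\psi\in\mathrm{Aut}(G)$, the generalized Alexander quandle $Q(G,\psi)$ is the set $G$ equipped with the point symmetries $s_x(y)=x\,\psi(x^{-1}y)$ for $x,y\in G$. An isomorphism of quandles $(Q,s)\to(Q',s')$ is a bijection $f:Q\to Q'$ with $f\circ s_x=s'_{f(x)}\circ f$ for all $x\in Q$; write $Q\cong_{\mathrm{qu}}Q'$ if one exists. Let $$\mathcal{Q}(G)=\{Q(G,\psi):\psi\in\mathrm{Aut}(G)\}/\cong_{\mathrm{qu}}$$ be the set of quandle isomorphism classes of generalized Alexander quandles of $G$. **Corollary 1.3.** For every $n\ge 0$, let $\mathfrak{S}_n$ be the symmetric group on $\{1,\dots,n\}$. Then $\mathcal{Q}(\mathfrak{S}_n)$ is in one-to-one correspondence with the set of conjugacy classes of $\mathrm{Aut}(\mathfrak{S}_n)$: sending the conjugacy class of $\psi$ to the isomorphism class of $Q(\mathfrak{S}_n,\psi)$ gives a well-defined bijection. Equivalently, for $\psi,\psi'\in\mathrm{Aut}(\mathfrak{S}_n)$, $Q(\mathfrak{S}_n,\psi)\cong_{\mathrm{qu}}Q(\mathfrak{S}_n,\psi')$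 if and only if $\psi$ and $\psi'$ are conjugate in $\mathrm{Aut}(\mathfrak{S}_n)$. -/

import Mathlib

namespace GenAlexander

/-- The generalized Alexander quandle `Q(G, ψ)`: the quandle structure on the underlying set
of `G` whose point symmetries are `s_x(y) = x ψ(x⁻¹ y)`.
In Mathlib's notation `s_x(y)` is `Shelf.act x y`. -/
@[reducible]
def alexQuandle {G : Type*} [Group G] (ψ : MulAut G) : Quandle G where
  act x y := x * ψ (x⁻¹ * y)
  invAct x y := x * ψ⁻¹ (x⁻¹ * y)
  self_distrib := by
    intro x y z
    simp [mul_assoc]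
  left_inv := by
    intro x y
    simp
  right_inv := by
    intro x y
    simp
  fix := by
    intro x
    simp

/-- Two quandles are isomorphic: there is a bijective quandle homomorphism from the first to
the second. -/
def Isomorphic (Q Q' : Type*) [Quandle Q] [Quandle Q'] : Prop :=
  ∃ f : ShelfHom Q Q', Function.Bijective f.toFun

/-- Isomorphism of two quandle structures on the same set `X`. -/
def QuandleIso {X : Type*} (q q' : Quandle X) : Prop :=
  @Isomorphic X X q q'

/-- Quandles are isomorphic iff there is a bijection `f` with `f ∘ s_x = s'_{f(x)} ∘ f`. -/
theorem isomorphic_iff (Q Q' : Type*) [Quandle Q] [Quandle Q'] :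
    Isomorphic Q Q' ↔ ∃ f : Q ≃ Q', ∀ x y, f (Shelf.act x y) = Shelf.act (f x) (f y) := by
  constructor
  · rintro ⟨f, hf⟩
    exact ⟨Equiv.ofBijective _ hf, fun x y => f.map_act'⟩
  · rintro ⟨f, hf⟩
    exact ⟨⟨f, fun {x y} => hf x y⟩, f.bijective⟩

theorem quandleIso_iff {X : Type*} (q q' : Quandle X) :
    QuandleIso q q' ↔ ∃ f : X ≃ X, ∀ x y, f (q.act x y) = q'.act (f x) (f y) :=
  @isomorphic_iff X X q q'

theorem quandleIso_equivalence (X : Type*) :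
    Equivalence (QuandleIso : Quandle X → Quandle X → Prop) where
  refl q := (quandleIso_iff q q).2 ⟨Equiv.refl X, fun _ _ => rfl⟩
  symm {q q'} h := by
    obtain ⟨f, hf⟩ := (quandleIso_iff q q').1 h
    refine (quandleIso_iff q' q).2 ⟨f.symm, fun x y => ?_⟩
    rw [Equiv.symm_apply_eq, hf, Equiv.apply_symm_apply, Equiv.apply_symm_apply]
  trans {q q' q''} h h' := by
    obtain ⟨f, hf⟩ := (quandleIso_iff q q').1 h
    obtain ⟨g, hg⟩ := (quandleIso_iff q' q'').1 h'
    refine (quandleIso_iff q q'').2 ⟨f.trans g, fun x y => ?_⟩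
    rw [Equiv.trans_apply, hf, hg, Equiv.trans_apply, Equiv.trans_apply]

/-- The set `{Q(G, ψ) : ψ ∈ Aut(G)}` of generalized Alexander quandles of `G`. -/
def alexQuandles (G : Type*) [Group G] : Set (Quandle G) :=
  {q | ∃ ψ : MulAut G, q = alexQuandle ψ}

/-- The relation of being isomorphic as quandles, on the generalized Alexander quandles
of `G`. -/
def alexSetoid (G : Type*) [Group G] : Setoid (alexQuandles G) where
  r q q' := QuandleIso q.1 q'.1
  iseqv := (quandleIso_equivalence G).comap Subtype.val

/-- The set of quandle isomorphism classes `{Q(G, ψ) : ψ ∈ Aut(G)} / ≅`. -/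
def AlexClasses (G : Type*) [Group G] : Type _ :=
  Quotient (alexSetoid G)

/-- The quandle isomorphism class of `Q(G, ψ)`. -/
def alexClass {G : Type*} [Group G] (ψ : MulAut G) : AlexClasses G :=
  Quotient.mk (alexSetoid G) ⟨alexQuandle ψ, ψ, rfl⟩

end GenAlexander

/-!
Conjugate automorphisms clearly give isomorphic quandles. Conversely, after a left translation an
isomorphism `f : Q(G, ψ) → Q(G, ψ')` fixes `1`, so it intertwines `ψ` and `ψ'` as permutations of
the set `G`. It also carries the left translations `s_x ∘ s_1⁻¹` by `x ψ(x)⁻¹` to those by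
`f(x) ψ'(f(x))⁻¹`. Hence it restricts to a group isomorphism between the subgroups `[G, ψ]` and
`[G, ψ']` generated by these elements (`IsPointedIso.displacementEquiv`). These subgroups are
normal.

Let `G = 𝔖_n` with `n ≥ 5`, and `ψ ≠ 1`. Then `[G, ψ]` is a nontrivial normal subgroup consisting
of even permutations, so it is the alternating group `𝔄_n`, and so is `[G, ψ']`. Thus `f` restricts
to an automorphism of `𝔄_n` intertwining `ψ` and `ψ'`. It extends to an automorphism `Φ` of `𝔖_n`
(`exists_mulAut_perm_extending`), and `Φ ψ = ψ' Φ` because an automorphism of `𝔖_n` is determined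
by its restriction to `𝔄_n` (`eq_one_of_forall_alternatingGroup`).

The extension is obtained without treating `n = 6` separately. The group `𝔖_n` embeds into
`Aut(𝔄_n)` by conjugation, and its image consists of the automorphisms that preserve the 3-cycles
(`exists_eq_conjNormal`). This image is normal (`range_conjNormal_normal`), since every permutation
of order 3 commutes with an odd permutation, so that its classes under `𝔖_n` and `𝔄_n` coincide.
Therefore `Aut(𝔄_n)` acts on the image, that is on `𝔖_n`, by conjugation.

For `n = 3, 4` every automorphism is inner, and `f` preserves the sizes of the fixed point sets of
`ψ` and of `ψ²`. If `ψ` is conjugation by `g`, these are the orders of the centralizers of `g` and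
`g²`, which determine the conjugacy class of `g`. For `n ≤ 2` the only automorphism is the identity.
-/

namespace GenAlexander

/-! ### Isomorphisms of generalized Alexander quandles and displacement groups -/

section Quandle

variable {G : Type*} [Group G]

/-- `IsPointedIso ψ ψ' f` says that the bijection `f` is an isomorphism of quandles
`Q(G, ψ) → Q(G, ψ')` which fixes the identity of `G`. -/
structure IsPointedIso (ψ ψ' : MulAut G) (f : G ≃ G) : Prop where
  map_one : f 1 = 1
  map_act : ∀ x y, f (x * ψ (x⁻¹ * y)) = f x * ψ' ((f x)⁻¹ * f y)

theorem quandleIso_of_isConj {ψ ψ' : MulAut G} (h : IsConj ψ ψ') :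
    QuandleIso (alexQuandle ψ) (alexQuandle ψ') := by
  obtain ⟨c, rfl⟩ := isConj_iff.1 h
  refine (quandleIso_iff _ _).2 ⟨c.toEquiv, fun x y => ?_⟩
  change c (x * ψ (x⁻¹ * y)) = c x * c (ψ (c⁻¹ ((c x)⁻¹ * c y)))
  simp

/-- Left translations are automorphisms of `Q(G, ψ')`, so an isomorphism may be assumed to fix
the identity. -/
theorem exists_isPointedIso {ψ ψ' : MulAut G}
    (h : QuandleIso (alexQuandle ψ) (alexQuandle ψ')) : ∃ f, IsPointedIso ψ ψ' f := by
  obtain ⟨f, hf⟩ := (quandleIso_iff _ _).1 h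
  replace hf : ∀ x y, f (x * ψ (x⁻¹ * y)) = f x * ψ' ((f x)⁻¹ * f y) := hf
  refine ⟨f.trans (Equiv.mulLeft (f 1)⁻¹), by simp, fun x y => ?_⟩
  simpa [mul_assoc] using hf x y

namespace IsPointedIso

variable {ψ ψ' : MulAut G} {f : G ≃ G}

theorem symm (h : IsPointedIso ψ ψ' f) : IsPointedIso ψ' ψ f.symm where
  map_one := by rw [Equiv.symm_apply_eq, h.map_one]
  map_act x y := by rw [Equiv.symm_apply_eq, h.map_act]; simp

theorem map_apply (h : IsPointedIso ψ ψ' f) (y : G) : f (ψ y) = ψ' (f y) := by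
  simpa [h.map_one] using h.map_act 1 y

theorem eq_one (h : IsPointedIso ψ ψ' f) (h1 : ψ = 1) : ψ' = 1 := by
  ext y
  obtain ⟨x, rfl⟩ := f.surjective y
  rw [← h.map_apply, h1]
  rfl

end IsPointedIso

/-- The subgroup `[G, ψ]` of `G` generated by the elements `x ψ(x)⁻¹`. Left translation by such
an element is `s_x ∘ s_1⁻¹`, so `[G, ψ]` acts on `Q(G, ψ)` as the group of displacements. -/
def displacement (ψ : MulAut G) : Subgroup G :=
  Subgroup.closure (Set.range fun x => x * (ψ x)⁻¹)

theorem mem_displacement (ψ : MulAut G) (x : G) : x * (ψ x)⁻¹ ∈ displacement ψ :=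
  Subgroup.subset_closure ⟨x, rfl⟩

instance displacement_normal (ψ : MulAut G) : (displacement ψ).Normal := by
  refine ⟨fun a ha g => ?_⟩
  have key : (displacement ψ).map (MulAut.conj g).toMonoidHom ≤ displacement ψ := by
    rw [displacement, MonoidHom.map_closure, Subgroup.closure_le]
    rintro _ ⟨_, ⟨x, rfl⟩, rfl⟩
    -- `g (x ψ(x)⁻¹) g⁻¹ = (g x) ψ(g x)⁻¹ · (g ψ(g)⁻¹)⁻¹`
    have := mul_mem (mem_displacement ψ (g * x)) (inv_mem (mem_displacement ψ g))
    change g * (x * (ψ x)⁻¹) * g⁻¹ ∈ displacement ψ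
    simpa [mul_assoc] using this
  exact key ⟨a, ha, rfl⟩

theorem displacement_eq_bot {ψ : MulAut G} (h : displacement ψ = ⊥) : ψ = 1 := by
  ext x
  have := mem_displacement ψ x
  rw [h, Subgroup.mem_bot, mul_inv_eq_one] at this
  exact this.symm

namespace IsPointedIso

variable {ψ ψ' : MulAut G} {f : G ≃ G}

/-- `f` carries the left translation by `x ψ(x)⁻¹` to the left translation by
`f(x) ψ'(f(x))⁻¹`, because it carries point symmetries to point symmetries. -/
theorem map_generator_mul (h : IsPointedIso ψ ψ' f) (x y : G) :
    f (x * (ψ x)⁻¹ * y) = f x * (ψ' (f x))⁻¹ * f y := by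
  have h1 := h.map_act x (ψ⁻¹ y)
  have h2 := h.map_apply (ψ⁻¹ y)
  simp only [map_mul, map_inv, MulAut.apply_inv_self, ← mul_assoc] at h1 h2
  rw [h1, h2]

theorem map_mul_and_mem (h : IsPointedIso ψ ψ' f) {a : G} (ha : a ∈ displacement ψ) :
    f a ∈ displacement ψ' ∧ ∀ y, f (a * y) = f a * f y := by
  have gen : ∀ x y, f (x * (ψ x)⁻¹ * y) = f (x * (ψ x)⁻¹) * f y := fun x y => by
    rw [h.map_generator_mul, ← mul_one (x * (ψ x)⁻¹), h.map_generator_mul, h.map_one, mul_one]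
  induction ha using Subgroup.closure_induction with
  | mem a ha =>
    obtain ⟨x, rfl⟩ := ha
    refine ⟨?_, gen x⟩
    have := h.map_generator_mul x 1
    rw [h.map_one, mul_one, mul_one] at this
    rw [this]
    exact mem_displacement ψ' (f x)
  | one => simp [h.map_one]
  | mul a b _ _ iha ihb =>
    refine ⟨iha.2 b ▸ mul_mem iha.1 ihb.1, fun y => ?_⟩
    rw [mul_assoc, iha.2, ihb.2, iha.2, mul_assoc]
  | inv a _ iha =>
    have hinv : f a⁻¹ = (f a)⁻¹ := by
      have := iha.2 a⁻¹
      rw [mul_inv_cancel, h.map_one] at this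
      exact (inv_eq_of_mul_eq_one_right this.symm).symm
    refine ⟨hinv ▸ inv_mem iha.1, fun y => ?_⟩
    have := iha.2 (a⁻¹ * y)
    rw [mul_inv_cancel_left] at this
    rw [hinv, this, inv_mul_cancel_left]

/-- A pointed isomorphism restricts to an isomorphism of displacement groups. -/
def displacementEquiv (h : IsPointedIso ψ ψ' f) : displacement ψ ≃* displacement ψ' where
  toFun a := ⟨f a, (h.map_mul_and_mem a.2).1⟩
  invFun a := ⟨f.symm a, (h.symm.map_mul_and_mem a.2).1⟩
  left_inv a := by simp
  right_inv a := by simp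
  map_mul' a b := Subtype.ext ((h.map_mul_and_mem a.2).2 b)

end IsPointedIso

end Quandle

/-! ### Symmetric groups of degree at most four -/

section SmallDegree

open Equiv

/-- The number of elements of a finite group commuting with `g`. -/
def centralizerCard {G : Type*} [Group G] [Fintype G] [DecidableEq G] (g : G) : ℕ :=
  (Finset.univ.filter fun y => g * y = y * g).card

theorem isConj_of_centralizerCard_three : ∀ g g' : Perm (Fin 3),
    centralizerCard g = centralizerCard g' → centralizerCard (g * g) = centralizerCard (g' * g') →
      ∃ c : Perm (Fin 3), c * g * c⁻¹ = g' := by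
  decide +kernel

theorem isConj_of_centralizerCard_four : ∀ g g' : Perm (Fin 4),
    centralizerCard g = centralizerCard g' → centralizerCard (g * g) = centralizerCard (g' * g') →
      ∃ c : Perm (Fin 4), c * g * c⁻¹ = g' := by
  decide +kernel

/-- Pairs satisfying the relations below are simultaneously conjugate to the standard generators
of the symmetric group. -/
theorem exists_conj_swap_finRotate_three : ∀ a b : Perm (Fin 3),
    a * a = 1 ∧ a ≠ 1 ∧ b * b * b = 1 ∧ b ≠ 1 →
      ∃ c : Perm (Fin 3), c * finRotate 3 * c⁻¹ = b ∧ c * swap 0 (finRotate 3 0) * c⁻¹ = a := by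
  decide +kernel

/-- Pairs satisfying the relations below are simultaneously conjugate to the standard generators
of the symmetric group. -/
theorem exists_conj_swap_finRotate_four : ∀ a b : Perm (Fin 4),
    a * a = 1 ∧ b * b ≠ 1 ∧ b * b * b * b = 1 ∧ a * b * (a * b) * (a * b) = 1 →
      ∃ c : Perm (Fin 4), c * finRotate 4 * c⁻¹ = b ∧ c * swap 0 (finRotate 4 0) * c⁻¹ = a := by
  decide +kernel

theorem mulAut_perm_ext {n : ℕ} {ψ χ : MulAut (Perm (Fin (n + 2)))}
    (h1 : ψ (finRotate (n + 2)) = χ (finRotate (n + 2)))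
    (h2 : ψ (swap 0 (finRotate (n + 2) 0)) = χ (swap 0 (finRotate (n + 2) 0))) : ψ = χ := by
  have := MonoidHom.eq_of_eqOn_dense (f := ψ.toMonoidHom) (g := χ.toMonoidHom)
    (Perm.closure_cycle_adjacent_swap (isCycle_finRotate (n := n)) support_finRotate 0) (by
      rintro _ (rfl | rfl)
      exacts [h1, h2])
  ext1 x
  exact DFunLike.congr_fun this x

theorem exists_eq_conj_three (ψ : MulAut (Perm (Fin 3))) : ∃ c, ψ = MulAut.conj c := by
  obtain ⟨c, hb, ha⟩ := exists_conj_swap_finRotate_three (ψ (swap 0 (finRotate 3 0)))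
    (ψ (finRotate 3)) (by
      simp only [← map_mul, ne_eq, MulEquivClass.map_eq_one_iff]
      decide +kernel)
  exact ⟨c, mulAut_perm_ext hb.symm ha.symm⟩

theorem exists_eq_conj_four (ψ : MulAut (Perm (Fin 4))) : ∃ c, ψ = MulAut.conj c := by
  obtain ⟨c, hb, ha⟩ := exists_conj_swap_finRotate_four (ψ (swap 0 (finRotate 4 0)))
    (ψ (finRotate 4)) (by
      simp only [← map_mul, ne_eq, MulEquivClass.map_eq_one_iff]
      decide +kernel)
  exact ⟨c, mulAut_perm_ext hb.symm ha.symm⟩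

/-- A bijection intertwining two inner automorphisms matches their fixed points, which are the
centralizers of the conjugating elements. -/
theorem centralizerCard_eq_of_intertwine {G : Type*} [Group G] [Fintype G] [DecidableEq G]
    {g g' : G} (f : G ≃ G) (hf : ∀ y, f (MulAut.conj g y) = MulAut.conj g' (f y)) :
    centralizerCard g = centralizerCard g' := by
  refine Finset.card_equiv f fun y => ?_
  simp only [Finset.mem_filter, Finset.mem_univ, true_and]
  rw [← mul_inv_eq_iff_eq_mul, ← mul_inv_eq_iff_eq_mul (b := g'), ← MulAut.conj_apply,
    ← MulAut.conj_apply, ← hf, f.injective.eq_iff]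

theorem IsPointedIso.centralizerCard_eq {G : Type*} [Group G] [Fintype G] [DecidableEq G]
    {g g' : G} {f : G ≃ G} (h : IsPointedIso (MulAut.conj g) (MulAut.conj g') f) :
    centralizerCard g = centralizerCard g' ∧
      centralizerCard (g * g) = centralizerCard (g' * g') := by
  refine ⟨centralizerCard_eq_of_intertwine f h.map_apply,
    centralizerCard_eq_of_intertwine f fun y => ?_⟩
  rw [map_mul, map_mul, MulAut.mul_apply, MulAut.mul_apply, h.map_apply, h.map_apply]

theorem IsPointedIso.isConj_of_le_four {n : ℕ} (hn : n ≤ 4) {ψ ψ' : MulAut (Perm (Fin n))}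
    {f : Perm (Fin n) ≃ Perm (Fin n)} (h : IsPointedIso ψ ψ' f) : IsConj ψ ψ' := by
  have key : (n = 3 ∨ n = 4) ∨ n = 0 ∨ n = 1 ∨ n = 2 := by omega
  rcases key with key | key
  · have inner : ∀ χ : MulAut (Perm (Fin n)), ∃ c, χ = MulAut.conj c := by
      rcases key with rfl | rfl
      exacts [exists_eq_conj_three, exists_eq_conj_four]
    obtain ⟨g, rfl⟩ := inner ψ
    obtain ⟨g', rfl⟩ := inner ψ'
    obtain ⟨h1, h2⟩ := h.centralizerCard_eq
    have hc : ∃ c, c * g * c⁻¹ = g' := by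
      rcases key with rfl | rfl
      exacts [isConj_of_centralizerCard_three _ _ h1 h2, isConj_of_centralizerCard_four _ _ h1 h2]
    exact MulAut.conj.map_isConj (isConj_iff.2 hc)
  · have two : ∀ x y : Perm (Fin n), x ≠ 1 → y ≠ 1 → x = y := by
      rcases key with rfl | rfl | rfl <;> decide +kernel
    have triv : ∀ χ : MulAut (Perm (Fin n)), χ = 1 := fun χ => by
      ext1 x
      by_cases hx : x = 1
      · rw [hx, _root_.map_one, MulAut.one_apply]
      · exact two _ _ (by simpa using hx) hx
    rw [triv ψ, triv ψ']

end SmallDegree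

/-! ### Three-cycles -/

section ThreeCycles

open Equiv Equiv.Perm

variable {α : Type*} [DecidableEq α]

/-- The 3-cycle `u ↦ v ↦ w ↦ u`, for distinct `u`, `v`, `w`. -/
def cyc (u v w : α) : Perm α := swap u v * swap v w

theorem cyc_inv {u v w : α} (huv : u ≠ v) (huw : u ≠ w) (hvw : v ≠ w) :
    (cyc u v w)⁻¹ = cyc v u w := by
  rw [inv_eq_iff_mul_eq_one]
  ext x
  simp only [cyc, Perm.mul_apply, swap_apply_def, Perm.one_apply]
  grind

theorem cyc_mul_cyc {p q i j : α} (hpq : p ≠ q) (hpi : p ≠ i) (hpj : p ≠ j) (hqi : q ≠ i)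
    (hqj : q ≠ j) (hij : i ≠ j) : cyc p q j * cyc p i q = cyc p i j := by
  ext x
  simp only [cyc, Perm.mul_apply, swap_apply_def]
  grind

theorem cyc_mul_cyc_sq {p q i j : α} (hpq : p ≠ q) (hpi : p ≠ i) (hpj : p ≠ j) (hqi : q ≠ i)
    (hqj : q ≠ j) (hij : i ≠ j) : cyc p q i * cyc p q j * (cyc p q i * cyc p q j) = 1 := by
  ext x
  simp only [cyc, Perm.mul_apply, swap_apply_def, Perm.one_apply]
  grind

theorem conj_cyc (s : Perm α) (u v w : α) : s * cyc u v w * s⁻¹ = cyc (s u) (s v) (s w) := by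
  rw [cyc, cyc, swap_apply_apply, swap_apply_apply]
  group

/-- If `H` contains all 3-cycles `p ↦ q ↦ i ↦ p`, it contains all 3-cycles moving `p`. -/
theorem cyc_mem_of_base {H : Subgroup (Perm α)} {p q : α} (hpq : p ≠ q)
    (h : ∀ i, i ≠ p → i ≠ q → cyc p q i ∈ H) {i j : α} (hi : i ≠ p) (hj : j ≠ p) (hij : i ≠ j) :
    cyc p i j ∈ H := by
  have aux : ∀ k, k ≠ p → k ≠ q → cyc p k q ∈ H := fun k hkp hkq => by
    -- `cyc p k q = (cyc p q k)⁻¹`, up to rotation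
    have : cyc p k q = (cyc p q k)⁻¹ := by
      rw [eq_comm, inv_eq_iff_mul_eq_one]
      ext x
      simp only [cyc, Perm.mul_apply, swap_apply_def, Perm.one_apply]
      grind
    rw [this]
    exact inv_mem (h k hkp hkq)
  by_cases hiq : i = q
  · subst hiq
    exact h j hj hij.symm
  by_cases hjq : j = q
  · subst hjq
    exact aux i hi hij
  rw [← cyc_mul_cyc hpq hi.symm hj.symm (Ne.symm hiq) (Ne.symm hjq) hij]
  exact mul_mem (h j hj hjq) (aux i hi hiq)

variable [Fintype α]

theorem isThreeCycle_cyc {u v w : α} (huv : u ≠ v) (huw : u ≠ w) (hvw : v ≠ w) :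
    IsThreeCycle (cyc u v w) := by
  rw [cyc, swap_comm u v]
  exact isThreeCycle_swap_mul_swap_same huv.symm hvw huw

theorem eq_cyc {g : Perm α} (hg : g.IsThreeCycle) {a : α} (ha : g a ≠ a) :
    g = cyc a (g a) (g (g a)) :=
  hg.eq_swap_mul_swap_iff_mem_support.2 (mem_support.2 ha)

theorem orbit_of_isThreeCycle {g : Perm α} (hg : g.IsThreeCycle) {a : α} (ha : g a ≠ a) :
    g (g a) ≠ a ∧ g (g (g a)) = a := by
  have h := hg.nodup_iff_mem_support.2 (mem_support.2 ha)
  have h3 : (g ^ 3) a = a := by simp [← hg.orderOf]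
  refine ⟨by grind, by simpa [pow_succ] using h3⟩

/-- The alternating group is generated by the 3-cycles `p ↦ q ↦ i ↦ p`, for fixed `p ≠ q`. -/
theorem alternatingGroup_le_of_cyc_mem {H : Subgroup (Perm α)} {p q : α} (hpq : p ≠ q)
    (h : ∀ i, i ≠ p → i ≠ q → cyc p q i ∈ H) : alternatingGroup α ≤ H := by
  rw [← closure_three_cycles_eq_alternating, Subgroup.closure_le]
  intro g hg
  obtain ⟨u, hu⟩ : ∃ u, g u ≠ u := by
    by_contra! hu
    exact IsThreeCycle.ne_one hg (Perm.ext hu)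
  have hd := (orbit_of_isThreeCycle hg hu).1
  rw [SetLike.mem_coe, eq_cyc hg hu]
  by_cases hup : u = p
  · subst hup
    exact cyc_mem_of_base hpq h hu hd (fun e => hu (g.injective e.symm))
  · -- the 3-cycles `u ↦ p ↦ i ↦ u` are the inverses of `p ↦ u ↦ i ↦ p`
    refine cyc_mem_of_base (q := p) hup (fun i hiu hip => ?_) hu hd
      (fun e => hu (g.injective e.symm))
    rw [← cyc_inv (Ne.symm hup) hip.symm hiu.symm]
    exact inv_mem (cyc_mem_of_base hpq h hup hip hiu.symm)

/-- Two 3-cycles whose product is an involution have the form `a ↦ b ↦ c ↦ a` and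
`a ↦ b ↦ d ↦ a` with `c ≠ d`. -/
theorem exists_common_edge {x y : Perm α} (hx : x.IsThreeCycle) (hy : y.IsThreeCycle)
    (h : x * y * (x * y) = 1) (h1 : x * y ≠ 1) :
    ∃ a, y a = x a ∧ x a ≠ a ∧ x (x a) ≠ y (x a) := by
  have hsq : ∀ t, x (y (x (y t))) = t := fun t => by
    simpa using congrArg (fun g : Perm α => g t) h
  obtain ⟨c, hc, hyc⟩ : ∃ c, x c ≠ c ∧ y c = c := by
    -- otherwise `x` and `y` have the same support, so that `y = x` or `y = x⁻¹`
    by_contra! hs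
    have hsub : x.support ⊆ y.support := fun t ht => mem_support.2 (hs t (mem_support.1 ht))
    have hsupp : x.support = y.support :=
      Finset.eq_of_subset_of_card_le hsub (by rw [hx.card_support, hy.card_support])
    obtain ⟨a, ha⟩ : ∃ a, x a ≠ a := by
      by_contra! hu
      exact hx.ne_one (Perm.ext hu)
    have hya := hs a ha
    have hxs := hx.support_eq_iff_mem_support.2 (mem_support.2 ha)
    have m1 : y a ∈ x.support := by
      rw [hsupp, apply_mem_support, mem_support]; exact hya
    have m2 : y (y a) ∈ x.support := by
      rw [hsupp, apply_mem_support, apply_mem_support, mem_support]; exact hya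
    obtain ⟨dx, dx3⟩ := orbit_of_isThreeCycle hx ha
    obtain ⟨dy, dy3⟩ := orbit_of_isThreeCycle hy hya
    have dy' : y (y a) ≠ y a := fun e => hya (y.injective e)
    rw [hxs] at m1 m2
    simp only [Finset.mem_insert, Finset.mem_singleton] at m1 m2
    have hxe := eq_cyc hx ha
    have hye := eq_cyc hy hya
    rcases m1 with m1 | m1 | m1
    · exact hya m1
    · have := hsq a
      have e : y (y a) = x (x a) := by grind
      have : y = x := by rw [hye, e, m1, ← hxe]
      subst this
      grind
    · refine h1 ?_
      have e : y (y a) = x a := by grind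
      have : y = x⁻¹ := by
        rw [hye, e, m1, hxe]
        rw [eq_comm, inv_eq_iff_mul_eq_one, ← hxe]
        ext t
        rw [hxe]
        simp only [cyc, Perm.mul_apply, swap_apply_def, Perm.one_apply]
        grind
      rw [this, mul_inv_cancel]
  obtain ⟨hd, hd3⟩ := orbit_of_isThreeCycle hx hc
  have e : y (x c) = x (x c) := by
    apply x.injective
    rw [hd3]
    nth_rw 1 [← hyc]
    exact hsq c
  refine ⟨x c, e, fun e => hc (x.injective e), ?_⟩
  rw [hd3]
  intro e'
  apply hd
  apply y.injective
  rw [← e', hyc]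

/-- Let `a ↦ b` be the arrow common to two 3-cycles of the form of `exists_common_edge`. If the
products of both with a third 3-cycle are involutions, then that arrow also belongs to the third
one: any other choice of shared arrows would give the third 3-cycle four moved points, or two
arrows with the same start or the same end. -/
theorem common_edge_third {x y z : Perm α} (hx : x.IsThreeCycle) (hy : y.IsThreeCycle)
    (hz : z.IsThreeCycle) {a : α} (hxy : y a = x a) (ha : x a ≠ a) (hne : x (x a) ≠ y (x a))
    (hxz : x * z * (x * z) = 1) (hxz1 : x * z ≠ 1)
    (hyz : y * z * (y * z) = 1) (hyz1 : y * z ≠ 1) : z a = x a := by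
  obtain ⟨b, hb, hb1, -⟩ := exists_common_edge hx hz hxz hxz1
  obtain ⟨c, hc, hc1, -⟩ := exists_common_edge hy hz hyz hyz1
  obtain ⟨dx, dx3⟩ := orbit_of_isThreeCycle hx ha
  obtain ⟨dy, dy3⟩ := orbit_of_isThreeCycle hy (hxy ▸ ha)
  have hzb := (hb ▸ hb1 : z b ≠ b)
  obtain ⟨dz, dz3⟩ := orbit_of_isThreeCycle hz hzb
  have mb : b ∈ x.support := mem_support.2 hb1
  have mc : c ∈ y.support := mem_support.2 hc1
  have mc' : c ∈ z.support := mem_support.2 (hc ▸ hc1)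
  rw [hx.support_eq_iff_mem_support.2 (mem_support.2 ha)] at mb
  rw [hy.support_eq_iff_mem_support.2 (mem_support.2 (hxy ▸ ha))] at mc
  rw [hz.support_eq_iff_mem_support.2 (mem_support.2 hzb)] at mc'
  simp only [Finset.mem_insert, Finset.mem_singleton] at mb mc mc'
  grind

end ThreeCycles

/-! ### Automorphisms of alternating and symmetric groups -/

section AlternatingGroup

open Equiv Equiv.Perm

variable {α : Type*} [DecidableEq α] [Fintype α]

/-- The map from the symmetric group to the automorphism group of the alternating group is
injective: a nontrivial kernel would contain the alternating group, which has trivial centre. -/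
theorem conjNormal_injective (h5 : 5 ≤ Nat.card α) : Function.Injective
    (MulAut.conjNormal : Perm α →* MulAut (alternatingGroup α)) := by
  rw [← MonoidHom.ker_eq_bot_iff]
  by_contra hbot
  have hle := Equiv.Perm.alternatingGroup_le_of_normal h5
    (N := (MulAut.conjNormal : Perm α →* MulAut (alternatingGroup α)).ker)
    ((Subgroup.nontrivial_iff_ne_bot _).2 hbot)
  have hnt := alternatingGroup.nontrivial_of_three_le_card (α := α) (by omega)
  obtain ⟨a, ha⟩ := exists_ne (1 : alternatingGroup α)
  apply ha
  rw [← Subgroup.mem_bot, ← alternatingGroup.center_eq_bot (α := α) (by omega),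
    Subgroup.mem_center_iff]
  intro b
  have hb := congrArg (fun θ : MulAut (alternatingGroup α) => ((θ a : alternatingGroup α) : Perm α))
    (MonoidHom.mem_ker.1 (hle b.2))
  simp only [MulAut.conjNormal_apply, MulAut.one_apply] at hb
  exact Subtype.ext (mul_inv_eq_iff_eq_mul.1 hb)

/-- An automorphism of the symmetric group is determined by its restriction to the alternating
group. -/
theorem eq_one_of_forall_alternatingGroup (h5 : 5 ≤ Nat.card α) {Ω : MulAut (Perm α)}
    (h : ∀ a ∈ alternatingGroup α, Ω a = a) : Ω = 1 := by
  ext1 g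
  apply conjNormal_injective h5
  ext1 a
  apply Subtype.ext
  rw [MulAut.conjNormal_apply, MulAut.one_apply, MulAut.conjNormal_apply]
  have h1 := h (g * a * g⁻¹) ((inferInstance : (alternatingGroup α).Normal).conj_mem _ a.2 g)
  rwa [map_mul, map_mul, map_inv, h a a.2] at h1

/-- An automorphism of the alternating group that preserves the set of 3-cycles is induced by a
permutation `s`. The images of the 3-cycles `p ↦ q ↦ i ↦ p` have products in pairs of order 2, so
they share one arrow `a ↦ b`, and are of the form `a ↦ b ↦ s i ↦ a`. -/
theorem exists_eq_conjNormal (h4 : 4 ≤ Nat.card α) (θ : MulAut (alternatingGroup α))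
    (hθ : ∀ x : alternatingGroup α, IsThreeCycle (x : Perm α) → IsThreeCycle (θ x : Perm α)) :
    ∃ s : Perm α, θ = MulAut.conjNormal s := by
  classical
  obtain ⟨p, q, i₀, i₁, hpq, hp0, hp1, hq0, hq1, h01⟩ : ∃ p q i₀ i₁ : α,
      p ≠ q ∧ p ≠ i₀ ∧ p ≠ i₁ ∧ q ≠ i₀ ∧ q ≠ i₁ ∧ i₀ ≠ i₁ := by
    rw [Nat.card_eq_fintype_card] at h4
    obtain ⟨e⟩ : Nonempty (Fin 4 ↪ α) :=
      Function.Embedding.nonempty_of_card_le (by simpa using h4)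
    exact ⟨e 0, e 1, e 2, e 3, by simp⟩
  let T : ∀ i, i ≠ p → i ≠ q → alternatingGroup α := fun i hp hq =>
    ⟨cyc p q i, (isThreeCycle_cyc hpq hp.symm hq.symm).mem_alternatingGroup⟩
  let σ : α → Perm α := fun i =>
    if h : i ≠ p ∧ i ≠ q then (θ (T i h.1 h.2) : Perm α) else 1
  have σ_eq : ∀ i hp hq, σ i = θ (T i hp hq) := fun i hp hq => dif_pos ⟨hp, hq⟩
  have σ3 : ∀ i, i ≠ p → i ≠ q → (σ i).IsThreeCycle := fun i hp hq => by
    rw [σ_eq i hp hq]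
    exact hθ _ (isThreeCycle_cyc hpq hp.symm hq.symm)
  have σ_inj : ∀ i j, i ≠ p → i ≠ q → j ≠ p → j ≠ q → σ i = σ j → i = j := by
    intro i j hip hiq hjp hjq e
    rw [σ_eq i hip hiq, σ_eq j hjp hjq] at e
    have e' := congrArg (fun t : alternatingGroup α => (t : Perm α) q)
      (θ.injective (Subtype.ext e))
    simpa [T, cyc, swap_apply_of_ne_of_ne, *] using e'
  have rel : ∀ i j, i ≠ p → i ≠ q → j ≠ p → j ≠ q → i ≠ j →
      σ i * σ j * (σ i * σ j) = 1 ∧ σ i * σ j ≠ 1 := by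
    intro i j hip hiq hjp hjq hij
    rw [σ_eq i hip hiq, σ_eq j hjp hjq]
    norm_cast
    rw [← map_mul, ← map_mul, MulEquivClass.map_eq_one_iff, MulEquivClass.map_eq_one_iff]
    refine ⟨Subtype.ext (cyc_mul_cyc_sq hpq hip.symm hjp.symm hiq.symm hjq.symm hij), fun e => ?_⟩
    have e' := congrArg (fun t : alternatingGroup α => (t : Perm α) p) e
    simp only [T, cyc, Subgroup.coe_mul, Subgroup.coe_one, Perm.mul_apply, Perm.one_apply,
      swap_apply_def] at e'
    grind
  obtain ⟨a, ha, hb, hne⟩ := exists_common_edge (σ3 i₀ hp0.symm hq0.symm)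
    (σ3 i₁ hp1.symm hq1.symm) (rel _ _ hp0.symm hq0.symm hp1.symm hq1.symm h01).1
    (rel _ _ hp0.symm hq0.symm hp1.symm hq1.symm h01).2
  obtain ⟨b, hbdef⟩ : ∃ b, b = σ i₀ a := ⟨_, rfl⟩
  have edge : ∀ i, i ≠ p → i ≠ q → σ i a = b := by
    intro i hip hiq
    by_cases h0 : i = i₀
    · rw [h0, hbdef]
    by_cases h1 : i = i₁
    · rw [h1, ha, hbdef]
    have r0 := rel i₀ i hp0.symm hq0.symm hip hiq (Ne.symm h0)
    have r1 := rel i₁ i hp1.symm hq1.symm hip hiq (Ne.symm h1)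
    rw [hbdef]
    exact common_edge_third (σ3 i₀ hp0.symm hq0.symm) (σ3 i₁ hp1.symm hq1.symm) (σ3 i hip hiq)
      ha hb hne r0.1 r0.2 r1.1 r1.2
  have hba : b ≠ a := hbdef ▸ hb
  have σ_cyc : ∀ i, i ≠ p → i ≠ q → σ i = cyc a b (σ i b) ∧ σ i b ≠ a ∧ σ i b ≠ b := by
    intro i hip hiq
    have e := edge i hip hiq
    have hm : σ i a ≠ a := e ▸ hba
    have h1 := eq_cyc (σ3 i hip hiq) hm
    have h2 := (orbit_of_isThreeCycle (σ3 i hip hiq) hm).1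
    rw [e] at h1 h2
    refine ⟨h1, h2, fun e' => hba ((σ i).injective (e'.trans e.symm))⟩
  let s' : α → α := fun i => if i = p then a else if i = q then b else σ i b
  have s_inj : Function.Injective s' := by
    intro i j hij
    by_contra hne
    have hσ := σ_inj i j
    have ci := σ_cyc i
    have cj := σ_cyc j
    simp only [s'] at hij
    grind
  let s : Perm α := Equiv.ofBijective s' (Finite.injective_iff_bijective.1 s_inj)
  have hs : ∀ i, i ≠ p → i ≠ q → s * cyc p q i * s⁻¹ = σ i := by
    intro i hip hiq
    have sp : s p = a := if_pos rfl
    have sq : s q = b := (if_neg hpq.symm).trans (if_pos rfl)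
    have si : s i = σ i b := (if_neg hip).trans (if_neg hiq)
    rw [conj_cyc, sp, sq, si, ← (σ_cyc i hip hiq).1]
  refine ⟨s, ?_⟩
  -- both sides agree on the generators `p ↦ q ↦ i ↦ p`
  let K : Subgroup (alternatingGroup α) :=
    MonoidHom.eqLocus θ.toMonoidHom (MulAut.conjNormal s).toMonoidHom
  have hK : alternatingGroup α ≤ K.map (alternatingGroup α).subtype := by
    refine alternatingGroup_le_of_cyc_mem hpq fun i hip hiq => ⟨T i hip hiq, ?_, rfl⟩
    apply Subtype.ext
    change (θ (T i hip hiq) : Perm α) = (MulAut.conjNormal s (T i hip hiq) : alternatingGroup α)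
    rw [MulAut.conjNormal_apply, ← σ_eq i hip hiq, ← hs i hip hiq]
  ext1 x
  obtain ⟨y, hy, hyx⟩ := hK x.2
  rw [← Subtype.ext hyx]
  exact hy

/-- On at least five points, a permutation of order dividing 3 commutes with some odd permutation:
either it has two 3-cycles, which can be exchanged, or it fixes two points, which can be
transposed. -/
theorem exists_odd_commute (h5 : 5 ≤ Nat.card α) {x : Perm α} (h : x ^ 3 = 1) :
    ∃ c : Perm α, c * x = x * c ∧ c ∉ alternatingGroup α := by
  by_contra! hc
  have hle : Subgroup.centralizer {x} ≤ alternatingGroup α := fun c hcx =>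
    hc c (Subgroup.mem_centralizer_singleton_iff.1 hcx)
  have h1 := card_le_of_centralizer_le_alternating hle
  have h2 := count_le_one_of_centralizer_le_alternating hle 3
  have : Fact (Nat.Prime 3) := ⟨Nat.prime_three⟩
  have h3 := Multiset.eq_replicate_card.2 (pow_prime_eq_one_iff.1 h)
  rw [h3, Multiset.count_replicate_self] at h2
  rw [h3, Multiset.sum_replicate, smul_eq_mul] at h1
  rw [Nat.card_eq_fintype_card] at h5
  omega

/-- The conjugates of a permutation of order dividing 3 are its conjugates by even permutations. -/
theorem exists_even_conj (h5 : 5 ≤ Nat.card α) {x : Perm α} (h : x ^ 3 = 1) (s : Perm α) :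
    ∃ e ∈ alternatingGroup α, s * x * s⁻¹ = e * x * e⁻¹ := by
  by_cases hs : s ∈ alternatingGroup α
  · exact ⟨s, hs, rfl⟩
  obtain ⟨c, hcx, hc⟩ := exists_odd_commute h5 h
  refine ⟨s * c, ?_, ?_⟩
  · rw [mem_alternatingGroup] at hs hc ⊢
    rw [Perm.sign_mul, (Int.units_eq_one_or _).resolve_left hs,
      (Int.units_eq_one_or _).resolve_left hc]
    rfl
  · rw [mul_assoc s c x, hcx]
    group

/-- The permutations induce a normal subgroup of the automorphism group of the alternating group.
Given an automorphism `φ` and a permutation `s`, the automorphism `φ ∘ s ∘ φ⁻¹` preserves the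
3-cycles: it maps a 3-cycle to a conjugate, since `s` maps `φ⁻¹` of that 3-cycle to a conjugate
under the alternating group. -/
theorem range_conjNormal_normal (h5 : 5 ≤ Nat.card α) :
    (MulAut.conjNormal : Perm α →* MulAut (alternatingGroup α)).range.Normal := by
  refine ⟨?_⟩
  rintro _ ⟨s, rfl⟩ φ
  obtain ⟨t, ht⟩ := exists_eq_conjNormal (by omega) (φ * MulAut.conjNormal s * φ⁻¹) (by
    intro y hy
    obtain ⟨x, rfl⟩ := φ.surjective y
    have hx : x ^ 3 = 1 := by
      apply φ.injective
      rw [map_pow, map_one]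
      exact Subtype.ext (by simpa [hy.orderOf] using pow_orderOf_eq_one (φ x : Perm α))
    obtain ⟨e, he, hse⟩ := exists_even_conj h5 (x := x)
      (by exact_mod_cast congrArg Subtype.val hx) s
    have hconj : (φ * MulAut.conjNormal s * φ⁻¹ : MulAut (alternatingGroup α)) (φ x) =
        φ ⟨e, he⟩ * φ x * (φ ⟨e, he⟩)⁻¹ := by
      rw [MulAut.mul_apply, MulAut.mul_apply, MulAut.inv_apply_self, ← map_inv, ← map_mul,
        ← map_mul]
      congr 1
      exact Subtype.ext hse
    rw [hconj]
    change cycleType ((φ ⟨e, he⟩ : Perm α) * (φ x : Perm α) * (φ ⟨e, he⟩ : Perm α)⁻¹) = {3}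
    rw [cycleType_conj]
    exact hy)
  exact ⟨t, ht.symm⟩

/-- Every automorphism of the alternating group extends to an automorphism of the symmetric group,
namely to conjugation by it inside the automorphism group of the alternating group. -/
theorem exists_mulAut_perm_extending (h5 : 5 ≤ Nat.card α) (φ : MulAut (alternatingGroup α)) :
    ∃ Φ : MulAut (Perm α), ∀ a : alternatingGroup α, Φ a = φ a := by
  have := range_conjNormal_normal h5
  let ι := MonoidHom.ofInjective (conjNormal_injective h5)
  let Φ : MulAut (Perm α) := (ι.trans (MulAut.conjNormal φ)).trans ι.symm
  refine ⟨Φ, fun a => ?_⟩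
  have h1 : ι (Φ a) = MulAut.conjNormal φ (ι a) := by simp [Φ]
  have h2 : (MulAut.conjNormal (Φ a) : MulAut (alternatingGroup α)) =
      φ * MulAut.conjNormal (a : Perm α) * φ⁻¹ := congrArg Subtype.val h1
  apply conjNormal_injective h5
  rw [h2]
  ext1 x
  rw [MulAut.conjNormal_val, MulAut.conjNormal_val]
  simp [MulAut.mul_apply]

/-- Automorphisms of the symmetric group preserve signs, so displacements are even. -/
theorem displacement_le_alternatingGroup [Nontrivial α] (ψ : MulAut (Perm α)) :
    displacement ψ ≤ alternatingGroup α := by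
  rw [displacement, Subgroup.closure_le]
  rintro _ ⟨x, rfl⟩
  have hs : (sign : Perm α →* ℤˣ).comp ψ.toMonoidHom = sign :=
    eq_sign_of_surjective_hom ((sign_surjective α).comp ψ.surjective)
  have hx : sign (ψ x) = sign x := DFunLike.congr_fun hs x
  simp [mem_alternatingGroup, hx]

theorem displacement_eq_alternatingGroup (h5 : 5 ≤ Nat.card α) {ψ : MulAut (Perm α)}
    (h : ψ ≠ 1) : displacement ψ = alternatingGroup α := by
  have : Nontrivial α := by
    rw [← Finite.one_lt_card_iff_nontrivial]
    omega
  refine le_antisymm (displacement_le_alternatingGroup ψ) ?_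
  exact Equiv.Perm.alternatingGroup_le_of_normal h5
    ((Subgroup.nontrivial_iff_ne_bot _).2 fun e => h (displacement_eq_bot e))

theorem IsPointedIso.isConj_of_five_le (h5 : 5 ≤ Nat.card α) {ψ ψ' : MulAut (Perm α)}
    {f : Perm α ≃ Perm α} (h : IsPointedIso ψ ψ' f) : IsConj ψ ψ' := by
  by_cases h1 : ψ = 1
  · rw [h1, h.eq_one h1]
  have h1' : ψ' ≠ 1 := fun e => h1 (h.symm.eq_one e)
  have hD := displacement_eq_alternatingGroup h5 h1
  have hD' := displacement_eq_alternatingGroup h5 h1'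
  obtain ⟨Φ, hΦ⟩ := exists_mulAut_perm_extending h5
    ((MulEquiv.subgroupCongr hD.symm).trans
      (h.displacementEquiv.trans (MulEquiv.subgroupCongr hD')))
  replace hΦ : ∀ a ∈ alternatingGroup α, Φ a = f a := fun a ha => hΦ ⟨a, ha⟩
  have hψ : ∀ a ∈ alternatingGroup α, ψ a ∈ alternatingGroup α := fun a ha => by
    -- `ψ a = (a ψ(a)⁻¹)⁻¹ a`
    have := mul_mem (inv_mem (hD ▸ mem_displacement ψ a)) ha
    simpa using this
  have key : (Φ * ψ)⁻¹ * (ψ' * Φ) = 1 := eq_one_of_forall_alternatingGroup h5 fun a ha => by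
    rw [MulAut.mul_apply, MulAut.inv_apply, MulEquiv.symm_apply_eq, MulAut.mul_apply,
      MulAut.mul_apply, hΦ a ha, hΦ _ (hψ a ha), h.map_apply]
  refine isConj_iff.2 ⟨Φ, ?_⟩
  rw [inv_mul_eq_one] at key
  rw [key, mul_inv_cancel_right]

end AlternatingGroup

theorem isConj_iff_quandleIso {n : ℕ} {ψ ψ' : MulAut (Equiv.Perm (Fin n))} :
    IsConj ψ ψ' ↔ QuandleIso (alexQuandle ψ) (alexQuandle ψ') := by
  refine ⟨quandleIso_of_isConj, fun h => ?_⟩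
  obtain ⟨f, hf⟩ := exists_isPointedIso h
  rcases Nat.lt_or_ge 4 n with hn | hn
  · exact hf.isConj_of_five_le (by simpa using Nat.succ_le_of_lt hn)
  · exact hf.isConj_of_le_four hn

end GenAlexander

theorem corollary1p3 (n : ℕ) :
    ∃ F : ConjClasses (MulAut (Equiv.Perm (Fin n))) ≃
        GenAlexander.AlexClasses (Equiv.Perm (Fin n)),
      ∀ ψ : MulAut (Equiv.Perm (Fin n)),
        F (ConjClasses.mk ψ) = GenAlexander.alexClass ψ := by
  let F : ConjClasses (MulAut (Equiv.Perm (Fin n))) →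
      GenAlexander.AlexClasses (Equiv.Perm (Fin n)) :=
    Quotient.lift GenAlexander.alexClass fun _ _ h =>
      Quotient.sound (GenAlexander.isConj_iff_quandleIso.1 h)
  have hF : Function.Bijective F := by
    constructor
    · rintro ⟨ψ⟩ ⟨ψ'⟩ h
      exact Quotient.sound (GenAlexander.isConj_iff_quandleIso.2 (Quotient.exact h))
    · rintro ⟨_, ψ, rfl⟩
      exact ⟨ConjClasses.mk ψ, rfl⟩
  exact ⟨Equiv.ofBijective F hF, fun _ => rfl⟩
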